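/- Let $\lambda\ge 3$, $M=2^{\lambda}$, and let $\mathcal S=\{e^{j(2m-1)\pi/M}: m=1,\dots,M\}\subset\mathbb C$ be the $M$-PSK signal set. A nonzero complex number $s$ is called a singular fade state for $\mathcal S$ if there are two distinct pairs $(x_A,x_B)\neq(x_A',x_B')$ in $\mathcal S\times\mathcal S$ with $x_A+sx_B=x_A'+sx_B'$. A singularity removal constraint for $s$ is a nonempty set $c\subseteq\mathcal S\times\mathcal S$ such that $x_A+sx_B=x_A'+sx_B'$ for all $(x_A,x_B),(x_A',x_B')\in c$, and $x_A+sx_B\neq x_A'+sx_B'$ whenever $(x_A,x_B)\in c$ and $(x_A',x_B')\notin c$. The singularity removal graph $\mathcal G_s$ is the simple graph whose vertices are the singularity removal constraints for $s$, two distinct constraints $c,c'$ being adjacent if and only if there are $(x_A,x_B)\in c$ and $(x_A',x_B')\in c'$ with $x_A=x_A'$ or $x_B=x_B'$. A Latin square on $\mathcal S$ is an array with rows and columns indexed by $\mathcal S$, one symbol in each cell, in which no symbol is repeated in any row or in any column; it removes $s$ if all cells belonging to the same singularity removal constraint for $s$ contain the same symbol. Then for every singular fade state $s$ of $\mathcal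 S$: (i) there is a Latin square on $\mathcal S$ that contains exactly $M$ symbols and removes $s$; (ii) $\mathcal G_s$ is $M$-colourable: it has a proper vertex colouring that uses exactly $M$ colours. -/

import Mathlib

namespace TwoWayRelay

/-- The `M`-PSK signal set `{e^{j(2m-1)π/M} : m ∈ {1, …, M}}`. -/
def psk (M : ℕ) : Set ℂ :=
  {z | ∃ m ∈ Finset.Icc 1 M,
    z = Complex.exp ((((2 * (m : ℝ) - 1) * Real.pi / (M : ℝ) : ℝ) : ℂ) * Complex.I)}

/-- The point `x_A + s x_B` of the effective constellation at the relay (normalized by the fade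
coefficient `H_A`), for the fade state `s = H_B / H_A` and the transmitted pair `(x_A, x_B)`. -/
def effectivePoint {S : Set ℂ} (s : ℂ) (p : S × S) : ℂ :=
  (p.1 : ℂ) + s * (p.2 : ℂ)

/-- A fade state `s = H_B / H_A` (a nonzero complex number, both links being present) is singular
for the signal set `S` if the minimum distance of the effective constellation is zero, i.e. two
different transmitted pairs give the same point. -/
def IsSingularFadeState (S : Set ℂ) (s : ℂ) : Prop :=
  s ≠ 0 ∧ ∃ p q : S × S, p ≠ q ∧ effectivePoint s p = effectivePoint s q

/-- A singularity removal constraint: a nonempty set of cells on which `x_A + s x_B` is constant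
and which contains every cell with that value. -/
def IsRemovalConstraint (S : Set ℂ) (s : ℂ) (c : Set (S × S)) : Prop :=
  c.Nonempty ∧
  (∀ p ∈ c, ∀ q ∈ c, effectivePoint s p = effectivePoint s q) ∧
  (∀ p ∈ c, ∀ q ∉ c, effectivePoint s p ≠ effectivePoint s q)

/-- The set `𝒞(s)` of singularity removal constraints, as a type. -/
abbrev RemovalConstraint (S : Set ℂ) (s : ℂ) : Type :=
  {c : Set (S × S) // IsRemovalConstraint S s c}

/-- The singularity removal graph: its vertices are the singularity removal constraints; two
different ones are adjacent iff they have cells in a common row or in a common column. -/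
def removalGraph (S : Set ℂ) (s : ℂ) : SimpleGraph (RemovalConstraint S s) where
  Adj c d := c ≠ d ∧ ∃ p ∈ c.1, ∃ q ∈ d.1, p.1 = q.1 ∨ p.2 = q.2
  symm := ⟨by
    rintro c d ⟨hne, p, hp, q, hq, h⟩
    exact ⟨hne.symm, q, hq, p, hp, h.imp Eq.symm Eq.symm⟩⟩
  loopless := ⟨fun _ h => h.1 rfl⟩

/-- A Latin square with rows and columns indexed by the signal set `S` and symbols in `T` (a map
obeying the exclusive law): no symbol repeats in a row or in a column. -/
structure LatinSquare (S : Set ℂ) (T : Type) where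
  /-- The symbol in the cell `(x_A, x_B)`. -/
  entry : S × S → T
  row_exclusion : ∀ a b b' : S, b ≠ b' → entry (a, b) ≠ entry (a, b')
  col_exclusion : ∀ a a' b : S, a ≠ a' → entry (a, b) ≠ entry (a', b)

/-- A Latin square removes the fade state `s` if all cells that belong to the same singularity
removal constraint are filled with the same symbol. -/
def LatinSquare.Removes {S : Set ℂ} {T : Type} (L : LatinSquare S T) (s : ℂ) : Prop :=
  ∀ c : Set (S × S), IsRemovalConstraint S s c → ∀ p ∈ c, ∀ q ∈ c, L.entry p = L.entry q

end TwoWayRelay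


/-! Up to a rotation, the signal set consists of the powers of a primitive root of unity `ω` of
order `2 ^ n`. A vanishing sum of such powers pairs off antipodally, because the minimal polynomial
of `ω` is `X ^ 2 ^ (n - 1) + 1`.

Let `s` be a fade state with a collision in which the exponents change by `k` in the first
coordinate and by `l` in the second. If `k = ± l`, then `s` is a power of `ω`, every collision
comes from `ω ^ x + ω ^ y = ω ^ x' + ω ^ y'`, and the bitwise exclusive or of `x` and `y` removes
`s`. Otherwise, eliminating `s` from two collisions and comparing the result with its complex
conjugate gives a vanishing sum of eight powers of `ω`; it forces every collision to be, up to a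
translation, `(b, b) ~ (b - k, b - l)` or `(b + h, b - l) ~ (b + h - k, b)` with `h = 2 ^ (n - 1)`.
These cells lie on four diagonals of the Latin square `a - b`, and writing suitable symbols into at
most eight of its diagonals makes the colliding cells equal. -/
namespace TwoWayRelay

open Function

/-- Latin arrays, with rows indexed by `α`, columns by `β` and symbols in `γ`: no symbol is
repeated in a column or in a row. -/
def IsLatin {α β γ : Type*} (f : α → β → γ) : Prop :=
  (∀ b, Injective fun a => f a b) ∧ ∀ a, Injective (f a)

/-- A rule for refilling some diagonals of the difference table `a - b` of a group, keeping the
rows and the columns Latin. The cells of the `i`-th diagonal are the `(b + diagonal i, b)`, and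
`symbol i b` is the index of the diagonal whose old symbol is written into that cell. -/
structure DiagonalFilling (ι A : Type*) [AddCommGroup A] where
  diagonal : ι → A
  symbol : ι → A → ι
  diagonal_injective : Injective diagonal
  symbol_column_injective (b : A) : Injective fun i => symbol i b
  symbol_row_injective (a : A) : Injective fun i => symbol i (a - diagonal i)

/-- The requirement that the array `f` identifies two families of pairs of cells, `h` being the
element of order two of a cyclic `2`-group. After a translation of the rows, every collision of a
fade state that is not a root of unity is of this form. -/
def Compatible {A : Type*} [AddCommGroup A] (h k l : A) (f : A → A → A) : Prop :=
  (∀ b, f b b = f (b - k) (b - l)) ∧ ∀ b, f (b + h) (b - l) = f (b + h - k) b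

theorem extend_comp_injective {ι A : Type*} {δ : ι → A} (hδ : Injective δ) {σ : ι → ι}
    (hσ : Injective σ) : Injective (extend δ (δ ∘ σ) id) := by
  have on_diagonal (i : ι) : extend δ (δ ∘ σ) id (δ i) = δ (σ i) := hδ.extend_apply ..
  have off_diagonal (d : A) (hd : ¬ ∃ i, δ i = d) : extend δ (δ ∘ σ) id d = d :=
    extend_apply' _ _ _ hd
  intro d d' h
  by_cases hd : ∃ i, δ i = d <;> by_cases hd' : ∃ i, δ i = d'
  · obtain ⟨i, rfl⟩ := hd
    obtain ⟨j, rfl⟩ := hd'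
    rw [on_diagonal, on_diagonal] at h
    rw [hσ (hδ h)]
  · obtain ⟨i, rfl⟩ := hd
    rw [on_diagonal, off_diagonal _ hd'] at h
    exact absurd ⟨_, h⟩ hd'
  · obtain ⟨j, rfl⟩ := hd'
    rw [on_diagonal, off_diagonal _ hd] at h
    exact absurd ⟨_, h.symm⟩ hd
  · rwa [off_diagonal _ hd, off_diagonal _ hd'] at h

section DiagonalFilling

variable {A ι κ : Type*} [AddCommGroup A]

namespace DiagonalFilling

theorem exists_isLatin (F : DiagonalFilling ι A) :
    ∃ f : A → A → A, IsLatin f ∧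
      ∀ i b, f (b + F.diagonal i) b = F.diagonal (F.symbol i b) := by
  let δ := F.diagonal
  refine ⟨fun a b => extend δ (δ ∘ (F.symbol · b)) id (a - b), ⟨fun b => ?_, fun a => ?_⟩,
    fun i b => ?_⟩
  · exact (extend_comp_injective F.diagonal_injective (F.symbol_column_injective b)).comp
      sub_left_injective
  · have row_eq (b : A) : extend δ (δ ∘ (F.symbol · b)) id (a - b) =
        extend δ (δ ∘ fun i => F.symbol i (a - δ i)) id (a - b) := by
      by_cases h : ∃ i, δ i = a - b
      · obtain ⟨i, hi⟩ := h
        rw [← hi, F.diagonal_injective.extend_apply, F.diagonal_injective.extend_apply,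
          comp_apply, comp_apply, hi, sub_sub_cancel]
      · rw [extend_apply' _ _ _ h, extend_apply' _ _ _ h]
    simp only [row_eq]
    exact (extend_comp_injective F.diagonal_injective (F.symbol_row_injective a)).comp
      sub_right_injective
  · simp only [add_sub_cancel_left]
    exact F.diagonal_injective.extend_apply ..

/-- The filling moved by `c` along the rows. -/
def shift (F : DiagonalFilling ι A) (c : A) : DiagonalFilling ι A where
  diagonal i := c + F.diagonal i
  symbol := F.symbol
  diagonal_injective := (add_right_injective c).comp F.diagonal_injective
  symbol_column_injective := F.symbol_column_injective
  symbol_row_injective a := by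
    simpa only [sub_sub] using F.symbol_row_injective (a - c)

/-- Two fillings of disjoint families of diagonals, used simultaneously. -/
def sum (F : DiagonalFilling ι A) (F' : DiagonalFilling κ A)
    (disjoint : ∀ i j, F.diagonal i ≠ F'.diagonal j) : DiagonalFilling (ι ⊕ κ) A where
  diagonal := Sum.elim F.diagonal F'.diagonal
  symbol x b := x.map (F.symbol · b) (F'.symbol · b)
  diagonal_injective := F.diagonal_injective.sumElim F'.diagonal_injective disjoint
  symbol_column_injective b :=
    (F.symbol_column_injective b).sumMap (F'.symbol_column_injective b)
  symbol_row_injective a := by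
    convert (F.symbol_row_injective a).sumMap (F'.symbol_row_injective a) using 2 with x
    cases x <;> rfl

/-- The filling writes the same symbol into the cells `(b, b)` and `(b - k, b - l)`. -/
def Merges (F : DiagonalFilling ι A) (k l : A) : Prop :=
  ∃ i j, F.diagonal i = 0 ∧ F.diagonal j = l - k ∧ ∀ b, F.symbol i b = F.symbol j (b - l)

theorem Merges.apply_eq {F : DiagonalFilling ι A} {k l : A} (hF : F.Merges k l) {c : A}
    {f : A → A → A} {g : ι → A}
    (hf : ∀ i b, f (b + (c + F.diagonal i)) b = g (F.symbol i b)) (b : A) :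
    f (b + c) b = f (b + c - k) (b - l) := by
  obtain ⟨i, j, hi, hj, hij⟩ := hF
  have hi' := hf i b
  have hj' := hf j (b - l)
  rw [hi, add_zero] at hi'
  rw [hj, show b - l + (c + (l - k)) = b + c - k by abel] at hj'
  rw [hi', hj', hij]

theorem exists_compatible_of_merges {h k l : A} (F : DiagonalFilling ι A)
    (F' : DiagonalFilling κ A) (hF : F.Merges k l) (hF' : F'.Merges (-k) l)
    (disjoint : ∀ i j, F.diagonal i ≠ h - k + F'.diagonal j) :
    ∃ f, IsLatin f ∧ Compatible h k l f := by
  obtain ⟨f, hf, hfF⟩ := (F.sum (F'.shift (h - k)) disjoint).exists_isLatin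
  refine ⟨f, hf, fun b => ?_, fun b => ?_⟩
  · simpa only [add_zero] using
      hF.apply_eq (c := 0) (g := F.diagonal) (fun i b => by rw [zero_add]; exact hfF (.inl i) b) b
  · have := hF'.apply_eq (g := (F'.shift (h - k)).diagonal) (fun j b => hfF (.inr j) b) b
    rw [show b + (h - k) = b + h - k by abel, sub_neg_eq_add, sub_add_cancel] at this
    exact this.symm

theorem exists_compatible_of_merges_self {h l : A} (hh : h + h = 0) (F : DiagonalFilling ι A)
    (hF : F.Merges h l) : ∃ f, IsLatin f ∧ Compatible h h l f := by
  obtain ⟨f, hf, hfF⟩ := F.exists_isLatin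
  have merged (b : A) : f b b = f (b - h) (b - l) := by
    simpa only [add_zero] using
      hF.apply_eq (c := 0) (g := F.diagonal) (fun i b => by rw [zero_add]; exact hfF i b) b
  refine ⟨f, hf, merged, fun b => ?_⟩
  rw [add_sub_cancel_right, merged b, show b + h = b - h by
    rw [sub_eq_add_neg, neg_eq_of_add_eq_zero_left hh]]

end DiagonalFilling

theorem Compatible.swap {h k l : A} (hh : h + h = 0) {f : A → A → A}
    (hf : Compatible h k l f) : Compatible h l k fun a b => f b a := by
  refine ⟨fun b => hf.1 b, fun b => ?_⟩
  have := hf.2 (b + h)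
  rw [add_assoc b h h, hh, add_zero] at this
  exact this.symm

end DiagonalFilling

section TwoDiagonals

variable {A : Type*} [AddCommGroup A] {k l : A} {χ : A → ℤˣ}

/-- The main diagonal and the diagonal `l - k`, on which the symbol is chosen by a sign. -/
def twoDiagonalFilling (hχk : Antiperiodic χ k) (hχl : Antiperiodic χ l) (hkl : k ≠ l) :
    DiagonalFilling ℤˣ A where
  diagonal i := if i = 1 then 0 else l - k
  symbol i b := i * χ b
  diagonal_injective i j h := by
    have hlk : l - k ≠ 0 := sub_ne_zero.2 hkl.symm
    rcases Int.units_eq_one_or i with rfl | rfl <;> rcases Int.units_eq_one_or j with rfl | rfl <;>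
      simp_all
  symbol_column_injective b := mul_left_injective (χ b)
  symbol_row_injective a := by
    have periodic : Periodic χ (l - k) := hχl.sub hχk
    have row_eq (i : ℤˣ) : χ (a - if i = 1 then 0 else l - k) = χ a := by
      split_ifs
      exacts [by rw [sub_zero], periodic.sub_eq a]
    simpa only [row_eq] using mul_left_injective (χ a)

theorem twoDiagonalFilling_merges (hχk : Antiperiodic χ k) (hχl : Antiperiodic χ l)
    (hkl : k ≠ l) : (twoDiagonalFilling hχk hχl hkl).Merges k l :=
  ⟨1, -1, by simp [twoDiagonalFilling], by simp [twoDiagonalFilling], fun b => by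
    simp only [twoDiagonalFilling, hχl.sub_eq, one_mul, neg_mul_neg]⟩

theorem apply_twoDiagonalFilling_diagonal (hχk : Antiperiodic χ k) (hχl : Antiperiodic χ l)
    (hkl : k ≠ l) (i : ℤˣ) : χ ((twoDiagonalFilling hχk hχl hkl).diagonal i) = χ 0 := by
  have : χ (l - k) = χ 0 := by simpa using (hχl.sub hχk) 0
  simp only [twoDiagonalFilling]
  split_ifs
  exacts [rfl, this]

theorem exists_compatible_of_antiperiodic {h : A} (hχh : Periodic χ h) (hχk : Antiperiodic χ k)
    (hχl : Antiperiodic χ l) (hkl : k ≠ l) (hkl' : k ≠ -l) :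
    ∃ f, IsLatin f ∧ Compatible h k l f := by
  have hkl'' : -k ≠ l := fun e => hkl' (by rw [← e, neg_neg])
  refine (twoDiagonalFilling hχk hχl hkl).exists_compatible_of_merges
    (twoDiagonalFilling hχk.neg hχl hkl'') (twoDiagonalFilling_merges ..)
    (twoDiagonalFilling_merges ..) fun i j e => ?_
  have := congrArg χ e
  rw [apply_twoDiagonalFilling_diagonal hχk hχl, add_comm, (hχh.sub_antiperiod hχk) _,
    apply_twoDiagonalFilling_diagonal hχk.neg hχl] at this
  exact units_ne_neg_self _ this

end TwoDiagonals

section FourDiagonals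

variable {A : Type*} [AddCommGroup A] {k l x : A} {p χ : A → ℤˣ}

/-- The diagonals of `fourDiagonalFilling`. -/
def fourDiagonals (k l x : A) (i : ℤˣ × ℤˣ) : A :=
  if i.1 = 1 then if i.2 = 1 then 0 else x - k - l else if i.2 = 1 then l - k else -k

theorem apply_sub_fourDiagonals (hpk : Periodic p k) (hpx : Periodic p x)
    (hpl : Antiperiodic p l) (a : A) (i : ℤˣ × ℤˣ) :
    p (a - fourDiagonals k l x i) = i.1 * i.2 * p a := by
  have hlk : Antiperiodic p (l - k) := by
    simpa only [neg_sub] using (hpk.sub_antiperiod hpl).neg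
  obtain ⟨i₁, i₂⟩ := i
  rcases Int.units_eq_one_or i₁ with rfl | rfl <;> rcases Int.units_eq_one_or i₂ with rfl | rfl
  · simp [fourDiagonals]
  · simp [fourDiagonals, ((hpx.sub_period hpk).sub_antiperiod hpl).sub_eq]
  · simp [fourDiagonals, hlk.sub_eq]
  · simp [fourDiagonals, hpk a]

theorem fourDiagonals_injective (hpk : Periodic p k) (hpx : Periodic p x)
    (hpl : Antiperiodic p l) (hk : k ≠ 0) (hx : x ≠ l + l) : Injective (fourDiagonals k l x) := by
  rintro ⟨i₁, i₂⟩ ⟨j₁, j₂⟩ h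
  have parity : i₁ * i₂ = j₁ * j₂ := by
    have := congrArg (fun d => p (0 - d)) h
    simpa only [apply_sub_fourDiagonals hpk hpx hpl, mul_left_inj] using this
  have hx' : x - k - l ≠ l - k := fun e => hx (by
    rw [← sub_eq_zero] at e ⊢
    rw [← e]
    abel)
  rcases Int.units_eq_one_or i₁ with rfl | rfl <;> rcases Int.units_eq_one_or i₂ with rfl | rfl <;>
    rcases Int.units_eq_one_or j₁ with rfl | rfl <;>
      rcases Int.units_eq_one_or j₂ with rfl | rfl <;> simp_all [fourDiagonals]

/-- The diagonals `0`, `-k` and `l - k`, `x - k - l`, on which the symbol is chosen by two signs: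
`p` tells the first pair of diagonals from the second one. -/
def fourDiagonalFilling (hpk : Periodic p k) (hpx : Periodic p x) (hpl : Antiperiodic p l)
    (hχk : Antiperiodic χ k) (hχx : Antiperiodic χ x) (hk : k ≠ 0) (hx : x ≠ l + l) :
    DiagonalFilling (ℤˣ × ℤˣ) A where
  diagonal := fourDiagonals k l x
  symbol i b := (p b * i.1, i.2 * χ (if i.1 = 1 then b else b + l))
  diagonal_injective := fourDiagonals_injective hpk hpx hpl hk hx
  symbol_column_injective b i j h := by
    obtain ⟨h₁, h₂⟩ := Prod.ext_iff.1 h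
    have h₁ : i.1 = j.1 := mul_left_cancel h₁
    simp only [h₁] at h₂
    exact Prod.ext h₁ (mul_right_cancel h₂)
  symbol_row_injective a := by
    have row_fst (i : ℤˣ × ℤˣ) : p (a - fourDiagonals k l x i) * i.1 = i.2 * p a := by
      rw [apply_sub_fourDiagonals hpk hpx hpl, mul_comm, ← mul_assoc, ← mul_assoc,
        Int.units_mul_self, one_mul]
    have row_snd (i : ℤˣ × ℤˣ) : i.2 * χ (if i.1 = 1 then a - fourDiagonals k l x i
        else a - fourDiagonals k l x i + l) = i.1 * i.2 * χ (if i.2 = 1 then a else a + l) := by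
      have hkx : Periodic χ (k - x) := hχk.sub hχx
      obtain ⟨i₁, i₂⟩ := i
      rcases Int.units_eq_one_or i₁ with rfl | rfl <;>
        rcases Int.units_eq_one_or i₂ with rfl | rfl
      · simp [fourDiagonals]
      · simp [fourDiagonals, show a - (x - k - l) = a + l + (k - x) by abel, hkx (a + l)]
      · simp [fourDiagonals, show a - (l - k) + l = a + k by abel, hχk a]
      · simp [fourDiagonals, show a + k + l = a + l + k by abel, hχk (a + l)]
    intro i j h
    simp only [row_fst, row_snd, Prod.mk.injEq] at h
    have h₂ : i.2 = j.2 := mul_right_cancel h.1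
    rw [h₂] at h
    exact Prod.ext (mul_right_cancel (mul_right_cancel h.2)) h₂

theorem fourDiagonalFilling_merges (hpk : Periodic p k) (hpx : Periodic p x)
    (hpl : Antiperiodic p l) (hχk : Antiperiodic χ k) (hχx : Antiperiodic χ x) (hk : k ≠ 0)
    (hx : x ≠ l + l) : (fourDiagonalFilling hpk hpx hpl hχk hχx hk hx).Merges k l :=
  ⟨(1, 1), (-1, 1), by simp [fourDiagonalFilling, fourDiagonals],
    by simp [fourDiagonalFilling, fourDiagonals], fun b => by
      simp [fourDiagonalFilling, hpl.sub_eq]⟩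

theorem exists_compatible_self_of_periodic {h : A} (hh : h + h = 0) (hh0 : h ≠ 0)
    (hph : Periodic p h) (hpl : Antiperiodic p l) (hχh : Antiperiodic χ h) (hhl : h ≠ l + l) :
    ∃ f, IsLatin f ∧ Compatible h h l f :=
  (fourDiagonalFilling hph hph hpl hχh hχh hh0 hhl).exists_compatible_of_merges_self hh
    (fourDiagonalFilling_merges ..)

theorem fourDiagonals_ne_add_fourDiagonals_neg {c : A} (hpc : Periodic p c) (hpk : Periodic p k)
    (hpx : Periodic p x) (hpl : Antiperiodic p l) (hc : c ≠ 0) (hck : c ≠ -k)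
    (hck' : c ≠ -(k + k)) (hx : x ≠ l + l + (c + (k + k))) (hx' : x ≠ l + l - (c + (k + k)))
    (i j : ℤˣ × ℤˣ) : fourDiagonals k l x i ≠ c + fourDiagonals (-k) l x j := by
  intro e
  have parity : i.1 * i.2 = j.1 * j.2 := by
    have := congrArg (fun d => p (0 - d)) e
    simp only [← sub_sub, zero_sub] at this
    rw [apply_sub_fourDiagonals hpk.neg hpx hpl, hpc.neg.eq] at this
    rwa [← zero_sub, apply_sub_fourDiagonals hpk hpx hpl, mul_left_inj] at this
  obtain ⟨i₁, i₂⟩ := i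
  obtain ⟨j₁, j₂⟩ := j
  have neg_one_ne_one : (-1 : ℤˣ) ≠ 1 := by decide
  rcases Int.units_eq_one_or i₁ with rfl | rfl <;> rcases Int.units_eq_one_or i₂ with rfl | rfl <;>
    rcases Int.units_eq_one_or j₁ with rfl | rfl <;>
      rcases Int.units_eq_one_or j₂ with rfl | rfl <;>
        simp only [fourDiagonals, neg_one_ne_one, neg_one_ne_one.symm, mul_neg, mul_one, neg_neg,
          if_true, if_false] at e parity <;> grind

theorem exists_compatible_of_periodic {h : A} (hh : h + h = 0) (hh0 : h ≠ 0)
    (hph : Periodic p h) (hpk : Periodic p k) (hpx : Periodic p x) (hpl : Antiperiodic p l)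
    (hχk : Antiperiodic χ k) (hχx : Antiperiodic χ x) (hk : k ≠ 0) (hkh : k ≠ h)
    (hx : x ≠ l + l) (hxk : x ≠ l + l + (h + k)) (hxk' : x ≠ l + l - (h + k)) :
    ∃ f, IsLatin f ∧ Compatible h k l f := by
  have hhk : h - k + (k + k) = h + k := by abel
  refine (fourDiagonalFilling hpk hpx hpl hχk hχx hk hx).exists_compatible_of_merges
    (fourDiagonalFilling hpk.neg hpx hpl hχk.neg hχx (neg_ne_zero.2 hk) hx)
    (fourDiagonalFilling_merges ..) (fourDiagonalFilling_merges ..)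
    (fourDiagonals_ne_add_fourDiagonals_neg (hph.sub_period hpk) hpk hpx hpl
      (sub_ne_zero.2 hkh.symm) ?_ ?_ (by rwa [hhk]) (by rwa [hhk]))
  · exact fun e => hh0 (by simpa only [sub_eq_add_neg, add_eq_right] using e)
  · intro e
    have hk' : h = -k := by simpa only [sub_eq_add_neg, neg_add, add_left_inj] using e
    exact hkh (neg_injective (by rw [← hk', neg_eq_of_add_eq_zero_left hh]))

end FourDiagonals

section CyclicDiagonals

open scoped AddConstMap

variable {A : Type*} [AddCommGroup A] {N : ℕ} {w : A}

theorem nonempty_addConstMap_of_dvd_addOrderOf (hN : N ∣ addOrderOf w) :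
    Nonempty (A →+c[w, 1] ZMod N) := by
  let rep (b : A) : A := (b : A ⧸ AddSubgroup.zmultiples w).out
  have exists_index (b : A) : ∃ m : ℤ, m • w = -rep b + b :=
    AddSubgroup.mem_zmultiples_iff.1 (QuotientAddGroup.eq.1 (Quotient.out_eq _))
  choose index hindex using exists_index
  refine ⟨⟨fun b => (index b : ZMod N), fun b => ?_⟩⟩
  have rep_add : rep (b + w) = rep b :=
    congrArg Quotient.out (QuotientAddGroup.mk_add_of_mem b (AddSubgroup.mem_zmultiples w))
  have hzero : (index (b + w) - (index b + 1)) • w = 0 := by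
    rw [sub_zsmul, add_zsmul, one_zsmul, hindex, hindex, rep_add]
    abel
  have hdvd : (N : ℤ) ∣ index (b + w) - (index b + 1) :=
    (Int.natCast_dvd_natCast.2 hN).trans (addOrderOf_dvd_iff_zsmul_eq_zero.2 hzero)
  rw [← sub_eq_zero]
  exact_mod_cast (ZMod.intCast_zmod_eq_zero_iff_dvd _ N).2 hdvd

theorem exists_antiperiodic_of_even_addOrderOf (hw : Even (addOrderOf w)) :
    ∃ χ : A → ℤˣ, Antiperiodic χ w := by
  obtain ⟨χ⟩ := nonempty_addConstMap_of_dvd_addOrderOf (even_iff_two_dvd.1 hw)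
  have sign_add_one (u : ZMod 2) :
      (if u + 1 = 0 then 1 else -1 : ℤˣ) = -if u = 0 then 1 else -1 := by
    decide +revert
  exact ⟨fun b => if χ b = 0 then 1 else -1, fun b => by
    simp only [AddConstMapClass.map_add_const, sign_add_one]⟩

/-- The diagonals `0`, `w`, `2 • w`, …, on which the symbols are taken from the Latin array `T`. -/
def cyclicFilling {T : ZMod N → ZMod N → ZMod N} (hT : IsLatin T) (hw : addOrderOf w = N)
    (χ : A →+c[w, 1] ZMod N) : DiagonalFilling (ZMod N) A :=
  let multiple : ZMod N →+ A := ZMod.lift N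
    ⟨zmultiplesHom A w, by simp [← hw, addOrderOf_nsmul_eq_zero]⟩
  { diagonal := multiple
    symbol i b := T (χ b + i) (χ b)
    diagonal_injective := (ZMod.lift_injective _).2 fun m hm => by
      rw [ZMod.intCast_zmod_eq_zero_iff_dvd, ← hw]
      exact addOrderOf_dvd_iff_zsmul_eq_zero.2 hm
    symbol_column_injective b := (hT.1 (χ b)).comp (add_right_injective _)
    symbol_row_injective a := by
      have map_sub_multiple (i : ZMod N) : χ (a - multiple i) = χ a - i := by
        obtain ⟨m, rfl⟩ := ZMod.intCast_surjective i
        simp [multiple, AddConstMapClass.map_sub_zsmul]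
      simp only [map_sub_multiple, sub_add_cancel]
      exact (hT.2 (χ a)).comp sub_right_injective }

theorem cyclicFilling_diagonal_intCast {T : ZMod N → ZMod N → ZMod N} (hT : IsLatin T)
    (hw : addOrderOf w = N) (χ : A →+c[w, 1] ZMod N) (m : ℤ) :
    (cyclicFilling hT hw χ).diagonal m = m • w := by
  simp [cyclicFilling]

theorem cyclicFilling_merges {T : ZMod N → ZMod N → ZMod N} (hT : IsLatin T)
    (hw : addOrderOf w = N) (χ : A →+c[w, 1] ZMod N) {k l : ℤ}
    (hkl : ∀ u, T u u = T (u - k) (u - l)) :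
    (cyclicFilling hT hw χ).Merges (k • w) (l • w) := by
  refine ⟨(0 : ℤ), (l - k : ℤ), ?_, ?_, fun b => ?_⟩
  · rw [cyclicFilling_diagonal_intCast, zero_zsmul]
  · rw [cyclicFilling_diagonal_intCast, sub_zsmul, ← sub_eq_add_neg]
  · simp [cyclicFilling, AddConstMapClass.map_sub_zsmul, hkl (χ b)]

/-- A Latin array of order eight: after a permutation of the rows and one of the columns, the
symbols `0, …, 7` are combined by the bitwise exclusive or. -/
def xorArray (u v : ZMod 8) : ZMod 8 :=
  (![0, 2, 4, 5, 1, 3, 7, 6] u ^^^ ![0, 4, 3, 7, 2, 6, 1, 5] v : Fin 8)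

theorem isLatin_xorArray : IsLatin xorArray := by
  unfold IsLatin Injective
  decide

theorem xorArray_self (u : ZMod 8) : xorArray u u = xorArray (u - 4) (u - 2) := by
  decide +revert

theorem exists_compatible_of_addOrderOf_eq_eight (hw : addOrderOf w = 8) :
    ∃ f, IsLatin f ∧ Compatible (4 • w) (4 • w) (2 • w) f := by
  obtain ⟨χ⟩ := nonempty_addConstMap_of_dvd_addOrderOf hw.symm.dvd
  refine (cyclicFilling isLatin_xorArray hw χ).exists_compatible_of_merges_self ?_ ?_
  · rw [← add_nsmul, show 4 + 4 = addOrderOf w from hw.symm, addOrderOf_nsmul_eq_zero]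
  · exact_mod_cast cyclicFilling_merges isLatin_xorArray hw χ (k := 4) (l := 2)
      fun u => by exact_mod_cast xorArray_self u

end CyclicDiagonals

section TwoPow

/-- The relation "`x` is an odd multiple of `w`". In `ZMod (2 ^ n)`, the odd multiples of `2 ^ i`
are the elements of `2`-adic valuation `i`. -/
def IsOddMultiple {A : Type*} [AddCommGroup A] (w x : A) : Prop :=
  ∃ y : ℤ, Odd y ∧ x = y • w

theorem IsOddMultiple.refl {A : Type*} [AddCommGroup A] (w : A) : IsOddMultiple w w :=
  ⟨1, odd_one, (one_zsmul w).symm⟩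

theorem ne_of_antiperiodic_of_periodic {A : Type*} [AddCommGroup A] {χ : A → ℤˣ} {x y : A}
    (hx : Antiperiodic χ x) (hy : Periodic χ y) : x ≠ y := by
  rintro rfl
  exact units_ne_neg_self (χ 0) ((hy 0).symm.trans (hx 0))

variable {n : ℕ}

theorem two_pow_pred_add_self (hn : 0 < n) :
    (2 ^ (n - 1) + 2 ^ (n - 1) : ZMod (2 ^ n)) = 0 := by
  rw [← two_mul, mul_pow_sub_one hn.ne']
  exact_mod_cast ZMod.natCast_self (2 ^ n)

theorem two_pow_pred_ne_zero (hn : 0 < n) : (2 ^ (n - 1) : ZMod (2 ^ n)) ≠ 0 := by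
  have hdvd : ¬ 2 ^ n ∣ 2 ^ (n - 1) := Nat.pow_dvd_pow_iff_le_right'.not.2 (by omega)
  exact_mod_cast (ZMod.natCast_eq_zero_iff _ _).not.2 hdvd

theorem IsOddMultiple.eq_two_pow_pred (hn : 0 < n) {x : ZMod (2 ^ n)}
    (hx : IsOddMultiple (2 ^ (n - 1)) x) : x = 2 ^ (n - 1) := by
  obtain ⟨y, ⟨m, rfl⟩, rfl⟩ := hx
  rw [add_zsmul, mul_comm, mul_zsmul, two_zsmul, two_pow_pred_add_self hn, zsmul_zero, zero_add,
    one_zsmul]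

theorem IsOddMultiple.add_self {i : ℕ} {x : ZMod (2 ^ n)} (hx : IsOddMultiple (2 ^ i) x) :
    IsOddMultiple (2 ^ (i + 1)) (x + x) := by
  obtain ⟨y, hy, rfl⟩ := hx
  exact ⟨y, hy, by rw [← zsmul_add, pow_succ, mul_two]⟩

theorem exists_isOddMultiple_two_pow {x : ZMod (2 ^ n)} (hx : x ≠ 0) :
    ∃ i < n, IsOddMultiple (2 ^ i) x := by
  obtain ⟨i, m, hm, hval⟩ := Nat.exists_eq_two_pow_mul_odd ((ZMod.val_ne_zero x).2 hx)
  have hle : 2 ^ i ≤ x.val := hval ▸ Nat.le_mul_of_pos_right _ hm.pos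
  refine ⟨i, (Nat.pow_lt_pow_iff_right one_lt_two).1 (hle.trans_lt (ZMod.val_lt x)), m,
    by exact_mod_cast hm, ?_⟩
  rw [← ZMod.natCast_zmod_val x, hval]
  simp [mul_comm]

theorem addOrderOf_two_pow {i : ℕ} (hi : i ≤ n) :
    addOrderOf (2 ^ i : ZMod (2 ^ n)) = 2 ^ (n - i) := by
  have := ZMod.addOrderOf_coe (2 ^ i) (n := 2 ^ n) (by positivity)
  rw [Nat.gcd_eq_right (pow_dvd_pow 2 hi), Nat.pow_div hi two_pos] at this
  exact_mod_cast this

/-- The sign is the binary digit of index `i`. -/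
theorem exists_sign {i : ℕ} (hi : i < n) : ∃ χ : ZMod (2 ^ n) → ℤˣ,
    (∀ x, IsOddMultiple (2 ^ i) x → Antiperiodic χ x) ∧
      ∀ j > i, ∀ x, IsOddMultiple (2 ^ j) x → Periodic χ x := by
  obtain ⟨χ, hχ⟩ := exists_antiperiodic_of_even_addOrderOf (w := (2 ^ i : ZMod (2 ^ n)))
    (by rw [addOrderOf_two_pow hi.le]; exact even_two.pow_of_ne_zero (by omega))
  refine ⟨χ, ?_, ?_⟩
  · rintro _ ⟨_, ⟨m, rfl⟩, rfl⟩
    exact hχ.odd_zsmul_antiperiodic m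
  · rintro j hij _ ⟨y, -, rfl⟩
    obtain ⟨m, rfl⟩ := Nat.exists_eq_add_of_lt hij
    have even_multiple : y • (2 ^ (i + m + 1) : ZMod (2 ^ n)) = (2 * (y * 2 ^ m)) • 2 ^ i := by
      simp only [zsmul_eq_mul]
      push_cast
      ring
    rw [even_multiple]
    exact hχ.even_zsmul_periodic _

theorem exists_compatible_of_isOddMultiple {i : ℕ} (hi : i < n) {k l : ZMod (2 ^ n)}
    (hk : IsOddMultiple (2 ^ i) k) (hl : IsOddMultiple (2 ^ i) l) (hkl : k ≠ l)
    (hkl' : k ≠ -l) : ∃ f, IsLatin f ∧ Compatible (2 ^ (n - 1)) k l f := by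
  have hi' : i < n - 1 := by
    by_contra hi'
    obtain rfl : i = n - 1 := by omega
    exact hkl ((hk.eq_two_pow_pred (by omega)).trans (hl.eq_two_pow_pred (by omega)).symm)
  obtain ⟨χ, antiperiodic, periodic⟩ := exists_sign hi
  exact exists_compatible_of_antiperiodic (periodic _ hi' _ (.refl _)) (antiperiodic k hk)
    (antiperiodic l hl) hkl hkl'

theorem exists_compatible_of_lt_of_lt {i j : ℕ} (hji : j < i) (hi : i < n - 1)
    {k l : ZMod (2 ^ n)} (hk : IsOddMultiple (2 ^ i) k) (hl : IsOddMultiple (2 ^ j) l) :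
    ∃ f, IsLatin f ∧ Compatible (2 ^ (n - 1)) k l f := by
  set h : ZMod (2 ^ n) := 2 ^ (n - 1)
  have hh : h + h = 0 := two_pow_pred_add_self (by omega)
  have hh0 : h ≠ 0 := two_pow_pred_ne_zero (by omega)
  obtain ⟨p, p_antiperiodic, p_periodic⟩ := exists_sign (n := n) (i := j) (by omega)
  obtain ⟨q, q_antiperiodic, q_periodic⟩ := exists_sign (n := n) (i := j + 1) (by omega)
  obtain ⟨χ, χ_antiperiodic, χ_periodic⟩ := exists_sign (n := n) (i := i) (by omega)
  have hpk : Periodic p k := p_periodic i hji k hk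
  have hph : Periodic p h := p_periodic (n - 1) (by omega) h (.refl _)
  have hχk : Antiperiodic χ k := χ_antiperiodic k hk
  have hχh : Periodic χ h := χ_periodic (n - 1) hi h (.refl _)
  have hkh : k ≠ h := ne_of_antiperiodic_of_periodic hχk hχh
  have hk0 : k ≠ 0 := ne_of_antiperiodic_of_periodic hχk (fun b => by rw [add_zero])
  have hqh : Periodic q h := q_periodic (n - 1) (by omega) h (.refl _)
  have hqk : Periodic q (k + k) := q_periodic (i + 1) (by omega) _ hk.add_self
  have two_l_ne (y : ZMod (2 ^ n)) (hy : Periodic q y) : l + l ≠ y :=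
    ne_of_antiperiodic_of_periodic (q_antiperiodic _ hl.add_self) hy
  have compatible_of_x (x : ZMod (2 ^ n)) (hpx : Periodic p x) (hχx : Antiperiodic χ x)
      (hx : x ≠ l + l) (hxk : x ≠ l + l + (h + k)) (hxk' : x ≠ l + l - (h + k)) :=
    exists_compatible_of_periodic hh hh0 hph hpk hpx (p_antiperiodic l hl) hχk hχx hk0 hkh hx
      hxk hxk'
  by_cases hkl : k = l + l
  · refine compatible_of_x (h + k) (hph.add_period hpk) (hχh.add_antiperiod hχk) (by grind) ?_ ?_
    · have := two_l_ne 0 (fun b => by rw [add_zero])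
      grind
    · have := two_l_ne _ hqk
      grind
  · refine compatible_of_x k hpk hχk hkl ?_ ?_
    · have := two_l_ne _ hqh
      grind
    · have := two_l_ne _ (hqk.add_period hqh)
      grind

theorem exists_compatible_two_pow_pred {j : ℕ} (hn : 3 ≤ n) (hj : j < n - 1)
    {l : ZMod (2 ^ n)} (hl : IsOddMultiple (2 ^ j) l) :
    ∃ f, IsLatin f ∧ Compatible (2 ^ (n - 1)) (2 ^ (n - 1)) l f := by
  set h : ZMod (2 ^ n) := 2 ^ (n - 1)
  have hh : h + h = 0 := two_pow_pred_add_self (by omega)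
  have hh0 : h ≠ 0 := two_pow_pred_ne_zero (by omega)
  rcases (show j + 1 ≤ n - 1 by omega).lt_or_eq with hj' | hj'
  · obtain ⟨p, p_antiperiodic, p_periodic⟩ := exists_sign (n := n) (i := j) (by omega)
    obtain ⟨q, q_antiperiodic, q_periodic⟩ := exists_sign (n := n) (i := j + 1) (by omega)
    obtain ⟨χ, χ_antiperiodic, -⟩ := exists_sign (n := n) (i := n - 1) (by omega)
    have hhl : l + l ≠ h := ne_of_antiperiodic_of_periodic (q_antiperiodic _ hl.add_self)
      (q_periodic (n - 1) hj' h (.refl _))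
    exact exists_compatible_self_of_periodic hh hh0 (p_periodic (n - 1) hj h (.refl _))
      (p_antiperiodic l hl) (χ_antiperiodic h (.refl _)) hhl.symm
  · obtain ⟨y, -, rfl⟩ := id hl
    obtain ⟨j, rfl⟩ : ∃ i, j = i + 1 := ⟨j - 1, by omega⟩
    set w : ZMod (2 ^ n) := y • 2 ^ j
    have two_w : y • (2 ^ (j + 1) : ZMod (2 ^ n)) = 2 • w := by
      rw [pow_succ, mul_two, zsmul_add, two_nsmul]
    rw [two_w] at hl ⊢
    have four_w : 4 • w = h := by
      rw [show 4 • w = 2 • w + 2 • w by rw [← add_nsmul]]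
      exact (hj' ▸ hl.add_self).eq_two_pow_pred (by omega)
    have order : addOrderOf w = 2 ^ (2 + 1) := by
      refine addOrderOf_eq_prime_pow (by rwa [show 2 ^ 2 = 4 by rfl, four_w]) ?_
      rw [show 2 ^ (2 + 1) = 4 + 4 by rfl, add_nsmul, four_w, hh]
    simpa only [four_w] using exists_compatible_of_addOrderOf_eq_eight order

theorem exists_compatible (hn : 3 ≤ n) {k l : ZMod (2 ^ n)} (hk : k ≠ 0) (hl : l ≠ 0)
    (hkl : k ≠ l) (hkl' : k ≠ -l) : ∃ f, IsLatin f ∧ Compatible (2 ^ (n - 1)) k l f := by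
  obtain ⟨i, hi, hki⟩ := exists_isOddMultiple_two_pow hk
  obtain ⟨j, hj, hlj⟩ := exists_isOddMultiple_two_pow hl
  have exists_of_lt {i j : ℕ} {k l : ZMod (2 ^ n)} (hi : i < n) (hji : j < i)
      (hk : IsOddMultiple (2 ^ i) k) (hl : IsOddMultiple (2 ^ j) l) :
      ∃ f, IsLatin f ∧ Compatible (2 ^ (n - 1)) k l f := by
    rcases (Nat.le_sub_one_of_lt hi).lt_or_eq with hi' | rfl
    · exact exists_compatible_of_lt_of_lt hji hi' hk hl
    · rw [hk.eq_two_pow_pred (by omega)]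
      exact exists_compatible_two_pow_pred hn hji hl
  rcases lt_trichotomy i j with hij | rfl | hji
  · obtain ⟨f, hf, hfc⟩ := exists_of_lt hj hij hlj hki
    exact ⟨_, ⟨hf.2, hf.1⟩, hfc.swap (two_pow_pred_add_self (by omega))⟩
  · exact exists_compatible_of_isOddMultiple hi hki hlj hkl hkl'
  · exact exists_of_lt hi hji hki hlj

end TwoPow

section VanishingSums

open Polynomial

theorem coeff_zero_eq_coeff_of_X_pow_add_one_dvd {R : Type*} [CommRing R] {m : ℕ} {P : R[X]}
    (hP : P.natDegree < m + m) (hdvd : X ^ m + 1 ∣ P) : P.coeff 0 = P.coeff m := by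
  nontriviality R
  have hm : m ≠ 0 := by omega
  obtain ⟨Q, rfl⟩ := hdvd
  have hQ : Q.coeff m = 0 := by
    by_cases hQ0 : Q = 0
    · rw [hQ0, coeff_zero]
    have monic : (X ^ m + 1 : R[X]).Monic := monic_X_pow_add_C 1 hm
    have natDegree_eq : (X ^ m + 1 : R[X]).natDegree = m := natDegree_X_pow_add_C (r := 1)
    rw [monic.natDegree_mul' hQ0, natDegree_eq] at hP
    exact coeff_eq_zero_of_natDegree_lt (by omega)
  simp [add_mul, coeff_X_pow_mul', hQ, hm.symm]

theorem minpoly_eq_X_pow_add_one {K : Type*} [Field K] [CharZero K] {ζ : K} {m : ℕ}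
    (hζ : IsPrimitiveRoot ζ (2 ^ (m + 1))) : minpoly ℤ ζ = X ^ 2 ^ m + 1 := by
  rw [← cyclotomic_eq_minpoly hζ (by positivity), cyclotomic_prime_pow_eq_geom_sum Nat.prime_two]
  simp [Finset.sum_range_succ, add_comm]

theorem isPrimitiveRoot_stdAddChar_one (N : ℕ) [NeZero N] :
    IsPrimitiveRoot (ZMod.stdAddChar (1 : ZMod N)) N := by
  have h1 := ZMod.stdAddChar_coe (N := N) 1
  rw [Int.cast_one, Int.cast_one, mul_one] at h1
  exact h1 ▸ Complex.isPrimitiveRoot_exp N (NeZero.ne N)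

theorem stdAddChar_one_pow_val {N : ℕ} [NeZero N] (a : ZMod N) :
    ZMod.stdAddChar (1 : ZMod N) ^ a.val = ZMod.stdAddChar a := by
  rw [← AddChar.map_nsmul_eq_pow, nsmul_one, ZMod.natCast_zmod_val]

variable {n : ℕ}

theorem stdAddChar_two_pow_pred (hn : 0 < n) :
    ZMod.stdAddChar (2 ^ (n - 1) : ZMod (2 ^ n)) = -1 := by
  have hsq : ZMod.stdAddChar (2 ^ (n - 1) : ZMod (2 ^ n)) * ZMod.stdAddChar
      (2 ^ (n - 1) : ZMod (2 ^ n)) = 1 := by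
    rw [← AddChar.map_add_eq_mul, two_pow_pred_add_self hn, AddChar.map_zero_eq_one]
  refine (mul_self_eq_one_iff.1 hsq).resolve_left fun h => two_pow_pred_ne_zero hn ?_
  exact ZMod.injective_stdAddChar (h.trans (AddChar.map_zero_eq_one _).symm)

theorem stdAddChar_add_two_pow_pred (hn : 0 < n) (a : ZMod (2 ^ n)) :
    ZMod.stdAddChar (a + 2 ^ (n - 1)) = -ZMod.stdAddChar a := by
  rw [AddChar.map_add_eq_mul, stdAddChar_two_pow_pred hn, mul_neg_one]

/-- The sum is a polynomial of degree less than `2 ^ n` in a primitive root of unity, hence it is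
a multiple of the minimal polynomial `X ^ 2 ^ (n - 1) + 1`. -/
theorem exists_eq_add_of_sum_stdAddChar_eq_zero (hn : 0 < n) {ι : Type*} {s : Finset ι}
    {x : ι → ZMod (2 ^ n)} (hsum : ∑ j ∈ s, ZMod.stdAddChar (x j) = 0) {i : ι} (hi : i ∈ s) :
    ∃ j ∈ s, x j = x i + 2 ^ (n - 1) := by
  obtain ⟨m, rfl⟩ : ∃ m, n = m + 1 := ⟨n - 1, by omega⟩
  rw [Nat.add_sub_cancel]
  let P : ℤ[X] := ∑ j ∈ s, X ^ (x j - x i).val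
  have primitive := isPrimitiveRoot_stdAddChar_one (2 ^ (m + 1))
  have natDegree_lt : P.natDegree < 2 ^ m + 2 ^ m := by
    refine Nat.lt_of_le_pred (by positivity) (natDegree_sum_le_of_forall_le s _ fun j _ => ?_)
    rw [natDegree_X_pow, ← mul_two, ← pow_succ]
    exact Nat.le_pred_of_lt (ZMod.val_lt _)
  have aeval_eq_zero : aeval (ZMod.stdAddChar (1 : ZMod (2 ^ (m + 1)))) P = 0 := by
    simp [P, stdAddChar_one_pow_val, AddChar.map_sub_eq_div, ← Finset.sum_div, hsum]
  have coeff_eq : P.coeff 0 = P.coeff (2 ^ m) := by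
    refine coeff_zero_eq_coeff_of_X_pow_add_one_dvd natDegree_lt ?_
    rw [← minpoly_eq_X_pow_add_one primitive]
    exact minpoly.isIntegrallyClosed_dvd (primitive.isIntegral (by positivity)) aeval_eq_zero
  have coeff_pos : 0 < P.coeff 0 := by
    simp only [P, finsetSum_coeff, coeff_X_pow]
    exact Finset.sum_pos' (fun j _ => by positivity) ⟨i, hi, by simp⟩
  rw [coeff_eq, finsetSum_coeff] at coeff_pos
  obtain ⟨j, hj, hne⟩ := Finset.exists_ne_zero_of_sum_ne_zero coeff_pos.ne'
  refine ⟨j, hj, ?_⟩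
  have val_eq : 2 ^ m = (x j - x i).val := by
    by_contra h
    exact hne (by rw [coeff_X_pow, if_neg h])
  rw [← sub_eq_iff_eq_add', ← ZMod.natCast_zmod_val (x j - x i), ← val_eq]
  simp

end VanishingSums

section Collisions

open ZMod (stdAddChar)

/-- The array `f` identifies all the cells `(a, b)` with the same value of `ω ^ a + s * ω ^ b`,
where `ω` is the standard primitive `N`-th root of unity. -/
def Resolves {N : ℕ} [NeZero N] {T : Type*} (s : ℂ) (f : ZMod N → ZMod N → T) : Prop :=
  ∀ a b a' b', stdAddChar a + s * stdAddChar b = stdAddChar a' + s * stdAddChar b' →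
    f a b = f a' b'

/-- The sum of the roots of unity with exponents `t` and `σ - t`. -/
noncomputable def pairSum {N : ℕ} [NeZero N] (σ t : ZMod N) : ℂ :=
  stdAddChar t + stdAddChar (σ - t)

theorem eq_or_eq_sub_of_pairSum_eq {N : ℕ} [NeZero N] {σ t t' : ZMod N}
    (h : pairSum σ t = pairSum σ t') : t = t' ∨ t = σ - t' := by
  have mul_eq (u : ZMod N) : (stdAddChar u * stdAddChar (σ - u) : ℂ) = stdAddChar σ := by
    rw [← AddChar.map_add_eq_mul, add_sub_cancel]
  have factored :
      ((stdAddChar t - stdAddChar t') * (stdAddChar t - stdAddChar (σ - t')) : ℂ) = 0 := by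
    unfold pairSum at h
    linear_combination stdAddChar t * h - mul_eq t + mul_eq t'
  refine (mul_eq_zero.1 factored).imp ?_ ?_ <;>
    exact fun h => ZMod.injective_stdAddChar (sub_eq_zero.1 h)

theorem add_eq_add_of_sub_mul_sub_eq {N : ℕ} [NeZero N] {a a' b b' c c' d d' : ZMod N}
    (ha : a ≠ a') (hb : b ≠ b')
    (h : ((stdAddChar a - stdAddChar a') * (stdAddChar b - stdAddChar b') : ℂ) =
      (stdAddChar c - stdAddChar c') * (stdAddChar d - stdAddChar d')) :
    a + a' + (b + b') = c + c' + (d + d') := by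
  have sub_ne_zero {x y : ZMod N} (hxy : x ≠ y) : (stdAddChar x - stdAddChar y : ℂ) ≠ 0 :=
    sub_ne_zero.2 (ZMod.injective_stdAddChar.ne hxy)
  have conj_sub (x y : ZMod N) : starRingEnd ℂ (stdAddChar x - stdAddChar y) * stdAddChar (x + y) =
      -(stdAddChar x - stdAddChar y) := by
    rw [map_sub, ← AddChar.map_neg_eq_conj, ← AddChar.map_neg_eq_conj, sub_mul,
      ← AddChar.map_add_eq_mul, ← AddChar.map_add_eq_mul, neg_add_cancel_left,
      neg_add_cancel_comm_assoc]
    ring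
  have conj_h := congrArg (starRingEnd ℂ) h
  rw [map_mul, map_mul] at conj_h
  have conj_ne_zero := mul_ne_zero ((map_ne_zero (starRingEnd ℂ)).2 (sub_ne_zero ha))
    ((map_ne_zero (starRingEnd ℂ)).2 (sub_ne_zero hb))
  refine ZMod.injective_stdAddChar (mul_left_cancel₀ conj_ne_zero ?_)
  conv_rhs => rw [conj_h]
  simp only [AddChar.map_add_eq_mul _ (_ + _)]
  rw [mul_mul_mul_comm, conj_sub, conj_sub, mul_mul_mul_comm, conj_sub, conj_sub, neg_mul_neg,
    neg_mul_neg, h]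

variable {n : ℕ}

theorem pairSum_add_two_pow_pred (hn : 0 < n) (σ t : ZMod (2 ^ n)) :
    pairSum σ (t + 2 ^ (n - 1)) = -pairSum σ t := by
  have reflect : σ - (t + 2 ^ (n - 1)) = σ - t + 2 ^ (n - 1) := by
    linear_combination -two_pow_pred_add_self hn
  rw [pairSum, reflect, stdAddChar_add_two_pow_pred hn, stdAddChar_add_two_pow_pred hn,
    ← neg_add, ← pairSum]

theorem exists_pairSum_eq_neg (hn : 0 < n) {ι : Type*} {s : Finset ι} {σ : ZMod (2 ^ n)}
    {t : ι → ZMod (2 ^ n)} (hsum : ∑ j ∈ s, pairSum σ (t j) = 0) {i : ι} (hi : i ∈ s) :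
    ∃ j ∈ s, pairSum σ (t j) = -pairSum σ (t i) := by
  have hsum' : ∑ j ∈ s.disjSum s, stdAddChar (Sum.elim t (σ - t ·) j) = 0 := by
    rw [Finset.sum_disjSum, ← Finset.sum_add_distrib]
    exact hsum
  obtain ⟨j | j, hj, hji⟩ := exists_eq_add_of_sum_stdAddChar_eq_zero hn hsum'
    (Finset.inl_mem_disjSum.2 hi)
  · refine ⟨j, Finset.inl_mem_disjSum.1 hj, ?_⟩
    rw [← pairSum_add_two_pow_pred hn]
    exact congrArg (pairSum σ) hji
  · refine ⟨j, Finset.inr_mem_disjSum.1 hj, ?_⟩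
    have reflect : t j = σ - (t i + 2 ^ (n - 1)) := by
      rw [← (show σ - t j = t i + 2 ^ (n - 1) from hji), sub_sub_cancel]
    rw [← pairSum_add_two_pow_pred hn, reflect, pairSum, pairSum, sub_sub_cancel, add_comm]

theorem pairSum_eq_or_eq_neg_of_add_eq_add (hn : 0 < n) {σ t₁ t₂ t₃ t₄ : ZMod (2 ^ n)}
    (h : pairSum σ t₁ + pairSum σ t₄ = pairSum σ t₂ + pairSum σ t₃)
    (h₁₂ : pairSum σ t₁ ≠ pairSum σ t₂) :
    (pairSum σ t₁ = pairSum σ t₃ ∧ pairSum σ t₂ = pairSum σ t₄) ∨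
      (pairSum σ t₁ = -pairSum σ t₄ ∧ pairSum σ t₂ = -pairSum σ t₃) := by
  have antipode := pairSum_add_two_pow_pred hn σ
  have sum_eq_zero : ∑ i, pairSum σ (![t₁, t₄, t₂ + 2 ^ (n - 1), t₃ + 2 ^ (n - 1)] i) = 0 := by
    simp only [Fin.sum_univ_four, Matrix.cons_val, antipode]
    linear_combination h
  have case_zero (h₁ : pairSum σ t₁ = 0) :
      pairSum σ t₂ = pairSum σ t₄ ∨ pairSum σ t₂ = -pairSum σ t₃ := by
    have sum_eq_zero : ∑ i, pairSum σ (![t₂, t₃, t₄ + 2 ^ (n - 1)] i) = 0 := by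
      simp only [Fin.sum_univ_three, Matrix.cons_val, antipode]
      linear_combination h₁ - h
    have cancels := exists_pairSum_eq_neg hn sum_eq_zero (Finset.mem_univ 0)
    simp only [Finset.mem_univ, true_and, Fin.exists_fin_succ, Matrix.cons_val_zero,
      Matrix.cons_val_succ, antipode, IsEmpty.exists_iff, or_false] at cancels
    rcases cancels with h₂ | h₃ | h₄
    · exact absurd (h₁.trans (self_eq_neg.1 h₂).symm) h₁₂
    · exact .inr (by rw [h₃, neg_neg])
    · exact .inl (neg_injective h₄).symm
  have cancels := exists_pairSum_eq_neg hn sum_eq_zero (Finset.mem_univ 0)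
  simp only [Finset.mem_univ, true_and, Fin.exists_fin_succ, Matrix.cons_val_zero,
    Matrix.cons_val_succ, antipode, IsEmpty.exists_iff, or_false] at cancels
  rcases cancels with h₁ | h₄ | h₂ | h₃
  · have h₁ := self_eq_neg.1 h₁
    rcases case_zero h₁ with h₂ | h₂
    · exact .inl ⟨by linear_combination h + h₂, h₂⟩
    · exact .inr ⟨by linear_combination h + h₂, h₂⟩
  · exact .inr ⟨by linear_combination h₄, by linear_combination h₄ - h⟩
  · exact absurd (neg_injective h₂).symm h₁₂
  · exact .inl ⟨by linear_combination h₃, by linear_combination h₃ - h⟩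

theorem stdAddChar_add_eq_add (hn : 0 < n) {x y x' y' : ZMod (2 ^ n)}
    (h : (stdAddChar x + stdAddChar y : ℂ) = stdAddChar x' + stdAddChar y') :
    (y = x + 2 ^ (n - 1) ∧ y' = x' + 2 ^ (n - 1)) ∨ (x = x' ∧ y = y') ∨ (x = y' ∧ y = x') := by
  have sum_eq_zero : ∑ i, (stdAddChar (![x, y, x' + 2 ^ (n - 1), y' + 2 ^ (n - 1)] i) : ℂ) = 0 := by
    simp only [Fin.sum_univ_four, Matrix.cons_val, stdAddChar_add_two_pow_pred hn]
    linear_combination h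
  obtain ⟨i, -, hi⟩ := exists_eq_add_of_sum_stdAddChar_eq_zero hn sum_eq_zero (Finset.mem_univ 0)
  fin_cases i
  · simp [two_pow_pred_ne_zero hn] at hi
  · left
    obtain rfl : y = x + 2 ^ (n - 1) := hi
    refine ⟨rfl, ZMod.injective_stdAddChar ?_⟩
    rw [stdAddChar_add_two_pow_pred hn] at h ⊢
    linear_combination -h
  · right; left
    obtain rfl : x = x' := (add_right_cancel hi).symm
    exact ⟨rfl, ZMod.injective_stdAddChar (add_left_cancel h)⟩
  · right; right
    obtain rfl : x = y' := (add_right_cancel hi).symm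
    exact ⟨rfl, ZMod.injective_stdAddChar (add_left_cancel (h.trans (add_comm _ _)))⟩

theorem Compatible.apply_eq_of_pairSum {f : ZMod (2 ^ n) → ZMod (2 ^ n) → ZMod (2 ^ n)}
    (hn : 0 < n) {a₀ a₁ b₀ b₁ a b a' b' σ : ZMod (2 ^ n)}
    (hf : Compatible (2 ^ (n - 1)) (a₀ - a₁) (b₀ - b₁) f) (hkl : a₀ - a₁ ≠ b₀ - b₁)
    (hkl' : a₀ - a₁ ≠ -(b₀ - b₁)) (hσ : a + a' + (b₀ + b₁) = σ) (hσ' : a₀ + a₁ + (b + b') = σ)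
    (h : (pairSum σ (a + b₀) = pairSum σ (a₀ + b) ∧ pairSum σ (a + b₁) = pairSum σ (a₀ + b')) ∨
      (pairSum σ (a + b₀) = -pairSum σ (a₀ + b') ∧ pairSum σ (a + b₁) = -pairSum σ (a₀ + b))) :
    f (a - (a₀ - b₀)) b = f (a' - (a₀ - b₀)) b' := by
  simp only [← pairSum_add_two_pow_pred hn] at h
  have hh := two_pow_pred_add_self hn
  set h : ZMod (2 ^ n) := 2 ^ (n - 1)
  obtain ⟨hf₁, hf₂⟩ := hf
  rcases h with ⟨h₁, h₂⟩ | ⟨h₁, h₂⟩ <;>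
    rcases eq_or_eq_sub_of_pairSum_eq h₁ with h₁ | h₁ <;>
      rcases eq_or_eq_sub_of_pairSum_eq h₂ with h₂ | h₂
  · have ha : a - (a₀ - b₀) = b := by linear_combination h₁
    have hb' : b - (b₀ - b₁) = b' := by linear_combination h₂ - h₁
    have ha' : a' - (a₀ - b₀) = b - (a₀ - a₁) := by linear_combination hσ - hσ' - h₂
    rw [ha, ha', hf₁, hb']
  · exact absurd (by linear_combination h₂ - h₁ - hσ') hkl
  · exact absurd (by linear_combination h₁ - h₂ - hσ') hkl'
  · have ha : a - (a₀ - b₀) = b' - (a₀ - a₁) := by linear_combination h₁ - hσ'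
    have hb : b' - (b₀ - b₁) = b := by linear_combination h₂ - h₁
    have ha' : a' - (a₀ - b₀) = b' := by linear_combination hσ - h₂
    rw [ha, ha', hf₁, hb]
  · have ha : a - (a₀ - b₀) = b' + h := by linear_combination h₁
    have hb : b' - (b₀ - b₁) = b := by linear_combination h₂ - h₁
    have ha' : a' - (a₀ - b₀) = b' + h - (a₀ - a₁) := by linear_combination hσ - hσ' - h₂ - hh
    rw [ha, ha', ← hb, hf₂]
  · exact absurd (by linear_combination h₂ - h₁ - hσ' - hh) hkl
  · exact absurd (by linear_combination h₁ - h₂ - hσ' - hh) hkl'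
  · have ha : a - (a₀ - b₀) = b + h - (a₀ - a₁) := by linear_combination h₁ - hσ' - hh
    have hb' : b - (b₀ - b₁) = b' := by linear_combination h₂ - h₁
    have ha' : a' - (a₀ - b₀) = b + h := by linear_combination hσ - h₂
    rw [ha, ha', ← hb', hf₂]

theorem exists_eq_stdAddChar_of_sub_eq (hn : 0 < n) {s : ℂ} {a₀ a₁ b₀ b₁ : ZMod (2 ^ n)}
    (hb : b₀ ≠ b₁)
    (h₀ : (stdAddChar a₀ - stdAddChar a₁ : ℂ) = -s * (stdAddChar b₀ - stdAddChar b₁))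
    (h : a₀ - a₁ = b₀ - b₁ ∨ a₀ - a₁ = -(b₀ - b₁)) : ∃ m : ZMod (2 ^ n), s = stdAddChar m := by
  have sub_ne_zero : (stdAddChar b₀ - stdAddChar b₁ : ℂ) ≠ 0 :=
    sub_ne_zero.2 (ZMod.injective_stdAddChar.ne hb)
  rcases h with h | h
  · have h₁ : a₁ = a₀ - b₀ + b₁ := by linear_combination -h
    refine ⟨a₀ - b₀ + 2 ^ (n - 1), mul_right_cancel₀ sub_ne_zero ?_⟩
    nth_rw 1 [← sub_add_cancel a₀ b₀] at h₀
    rw [h₁, AddChar.map_add_eq_mul, AddChar.map_add_eq_mul] at h₀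
    rw [stdAddChar_add_two_pow_pred hn]
    linear_combination h₀
  · have h₁ : a₁ = a₀ - b₁ + b₀ := by linear_combination -h
    refine ⟨a₀ - b₁, mul_right_cancel₀ sub_ne_zero ?_⟩
    nth_rw 1 [← sub_add_cancel a₀ b₁] at h₀
    rw [h₁, AddChar.map_add_eq_mul, AddChar.map_add_eq_mul] at h₀
    linear_combination h₀

theorem Compatible.resolves {f : ZMod (2 ^ n) → ZMod (2 ^ n) → ZMod (2 ^ n)} (hn : 0 < n) {s : ℂ}
    {a₀ a₁ b₀ b₁ : ZMod (2 ^ n)} (hf : Compatible (2 ^ (n - 1)) (a₀ - a₁) (b₀ - b₁) f)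
    (ha : a₀ ≠ a₁) (hb : b₀ ≠ b₁) (hkl : a₀ - a₁ ≠ b₀ - b₁) (hkl' : a₀ - a₁ ≠ -(b₀ - b₁))
    (h₀ : (stdAddChar a₀ - stdAddChar a₁ : ℂ) = -s * (stdAddChar b₀ - stdAddChar b₁)) :
    Resolves s fun a b => f (a - (a₀ - b₀)) b := by
  intro a b a' b' h
  have sub_ne_zero {x y : ZMod (2 ^ n)} (hxy : x ≠ y) : (stdAddChar x - stdAddChar y : ℂ) ≠ 0 :=
    sub_ne_zero.2 (ZMod.injective_stdAddChar.ne hxy)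
  have hs : s ≠ 0 := by
    rintro rfl
    simp [sub_ne_zero ha] at h₀
  by_cases haa' : a = a'
  · subst haa'
    rw [ZMod.injective_stdAddChar (mul_left_cancel₀ hs (add_left_cancel h))]
  have cross_mul : ((stdAddChar a - stdAddChar a') * (stdAddChar b₀ - stdAddChar b₁) : ℂ) =
      (stdAddChar a₀ - stdAddChar a₁) * (stdAddChar b - stdAddChar b') := by
    linear_combination (stdAddChar b₀ - stdAddChar b₁ : ℂ) * h -
      (stdAddChar b - stdAddChar b' : ℂ) * h₀
  have exponents := add_eq_add_of_sub_mul_sub_eq haa' hb cross_mul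
  set σ := a₀ + a₁ + (b + b') with hσ
  have pairSum_eq {t u v w : ZMod (2 ^ n)} (h : t + u + (v + w) = σ) :
      pairSum σ (t + v) = stdAddChar t * stdAddChar v + stdAddChar u * stdAddChar w := by
    rw [pairSum, ← h, show t + u + (v + w) - (t + v) = u + w by ring, AddChar.map_add_eq_mul,
      AddChar.map_add_eq_mul]
  have h₁ := pairSum_eq exponents
  have h₂ := pairSum_eq (t := a) (u := a') (v := b₁) (w := b₀) (by rw [← exponents]; ring)
  have h₃ := pairSum_eq (t := a₀) (u := a₁) (v := b) (w := b') rfl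
  have h₄ := pairSum_eq (t := a₀) (u := a₁) (v := b') (w := b) (by rw [hσ]; ring)
  refine hf.apply_eq_of_pairSum hn hkl hkl' exponents hσ.symm
    (pairSum_eq_or_eq_neg_of_add_eq_add hn ?_ fun h₁₂ => ?_)
  · rw [h₁, h₂, h₃, h₄]
    linear_combination cross_mul
  · refine mul_ne_zero (sub_ne_zero haa') (sub_ne_zero hb) ?_
    rw [h₁, h₂] at h₁₂
    linear_combination h₁₂

theorem exists_digits (n : ℕ) : ∃ D : ZMod (2 ^ n) → Fin n → ℤˣ, Injective D ∧
    ∀ x y, D x * D (x + 2 ^ (n - 1)) = D y * D (y + 2 ^ (n - 1)) := by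
  choose χ antiperiodic periodic using fun i : Fin n => exists_sign i.2
  have separates {x y : ZMod (2 ^ n)} (hxy : ∀ i, χ i x = χ i y) : x = y := by
    by_contra hne
    obtain ⟨i, hi, hodd⟩ := exists_isOddMultiple_two_pow (sub_ne_zero.2 hne)
    have antiperiod := antiperiodic ⟨i, hi⟩ _ hodd y
    rw [add_sub_cancel, hxy] at antiperiod
    exact units_ne_neg_self _ antiperiod
  refine ⟨fun x i => χ i x, fun x y hxy => separates (congrFun hxy), fun x y => funext fun i => ?_⟩
  rcases (Nat.le_sub_one_of_lt i.2).lt_or_eq with hi | hi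
  · have period := periodic i (n - 1) hi _ (.refl _)
    simp only [Pi.mul_apply, period _, Int.units_mul_self]
  · have antiperiod := antiperiodic i (2 ^ (n - 1)) (by rw [hi]; exact .refl _)
    simp only [Pi.mul_apply, antiperiod _, mul_neg, Int.units_mul_self]

theorem exists_resolves_stdAddChar (hn : 0 < n) (m : ZMod (2 ^ n)) :
    ∃ f : ZMod (2 ^ n) → ZMod (2 ^ n) → Fin n → ℤˣ, IsLatin f ∧ Resolves (stdAddChar m) f := by
  obtain ⟨D, D_injective, antipodal⟩ := exists_digits n
  refine ⟨fun a b => D a * D (m + b), ⟨fun b => ?_, fun a => ?_⟩, fun a b a' b' h => ?_⟩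
  · exact (mul_left_injective _).comp D_injective
  · exact (mul_right_injective _).comp (D_injective.comp (add_right_injective m))
  · simp only [← AddChar.map_add_eq_mul] at h
    rcases stdAddChar_add_eq_add hn h with ⟨hb, hb'⟩ | ⟨ha, hb⟩ | ⟨ha, hb⟩
    · simp only [hb, hb', antipodal a a']
    · simp only [ha, hb]
    · simp only [← ha, hb, mul_comm]

end Collisions

section Constellation

open ZMod (stdAddChar)

variable {N : ℕ} [NeZero N] {s : ℂ}

theorem exists_equiv_psk (N : ℕ) [NeZero N] :
    ∃ (z : ℂ) (φ : ZMod N ≃ psk N), z ≠ 0 ∧ ∀ a, (φ a : ℂ) = z * stdAddChar a := by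
  let z : ℂ := Complex.exp ((Real.pi / N : ℝ) * Complex.I)
  have hz : z ≠ 0 := Complex.exp_ne_zero _
  have mul_stdAddChar (m : ℕ) : z * stdAddChar (m : ZMod N) = Complex.exp
      ((((2 * ((m + 1 : ℕ) : ℝ) - 1) * Real.pi / (N : ℝ) : ℝ) : ℂ) * Complex.I) := by
    rw [← Int.cast_natCast m, ZMod.stdAddChar_coe, ← Complex.exp_add]
    congr 1
    push_cast
    ring
  have mem_psk (a : ZMod N) : z * stdAddChar a ∈ psk N :=
    ⟨a.val + 1, Finset.mem_Icc.2 ⟨by omega, ZMod.val_lt a⟩,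
      by rw [← mul_stdAddChar, ZMod.natCast_zmod_val]⟩
  let φ (a : ZMod N) : psk N := ⟨z * stdAddChar a, mem_psk a⟩
  have φ_injective : Injective φ := fun a b h =>
    ZMod.injective_stdAddChar (mul_left_cancel₀ hz (congrArg Subtype.val h))
  have φ_surjective : Surjective φ := by
    rintro ⟨x, m, hm, rfl⟩
    refine ⟨((m - 1 : ℕ) : ZMod N), Subtype.ext ?_⟩
    simp only [φ, mul_stdAddChar, Nat.sub_add_cancel (Finset.mem_Icc.1 hm).1]
  exact ⟨z, Equiv.ofBijective φ ⟨φ_injective, φ_surjective⟩, hz, fun _ => rfl⟩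

theorem IsSingularFadeState.exists_sub_eq (hs : IsSingularFadeState (psk N) s) :
    ∃ a₀ a₁ b₀ b₁ : ZMod N, a₀ ≠ a₁ ∧ b₀ ≠ b₁ ∧
      (stdAddChar a₀ - stdAddChar a₁ : ℂ) = -s * (stdAddChar b₀ - stdAddChar b₁) := by
  obtain ⟨z, φ, hz, hφ⟩ := exists_equiv_psk N
  obtain ⟨hs0, ⟨x₀, y₀⟩, ⟨x₁, y₁⟩, hne, h⟩ := hs
  obtain ⟨⟨a₀, rfl⟩, a₁, rfl⟩ := And.intro (φ.surjective x₀) (φ.surjective x₁)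
  obtain ⟨⟨b₀, rfl⟩, b₁, rfl⟩ := And.intro (φ.surjective y₀) (φ.surjective y₁)
  simp only [effectivePoint, hφ] at h
  have sub_eq : (stdAddChar a₀ - stdAddChar a₁ : ℂ) = -s * (stdAddChar b₀ - stdAddChar b₁) :=
    mul_left_cancel₀ hz (by linear_combination h)
  have eq_iff : a₀ = a₁ ↔ b₀ = b₁ := by
    rw [← ZMod.injective_stdAddChar.eq_iff, ← sub_eq_zero, sub_eq, mul_eq_zero,
      or_iff_right (neg_ne_zero.2 hs0), sub_eq_zero, ZMod.injective_stdAddChar.eq_iff]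
  have ha : a₀ ≠ a₁ := by
    rintro rfl
    exact hne (by rw [eq_iff.1 rfl])
  exact ⟨a₀, a₁, b₀, b₁, ha, eq_iff.not.1 ha, sub_eq⟩

theorem exists_latinSquare_of_resolves {T : Type*} [Fintype T] (hT : Fintype.card T = N)
    {f : ZMod N → ZMod N → T} (hf : IsLatin f) (hfs : Resolves s f) :
    ∃ L : LatinSquare (psk N) (Fin N), Surjective L.entry ∧ L.Removes s := by
  obtain ⟨z, φ, hz, hφ⟩ := exists_equiv_psk N
  let e : T ≃ Fin N := Fintype.equivFinOfCardEq hT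
  let entry (p : psk N × psk N) : Fin N := e (f (φ.symm p.1) (φ.symm p.2))
  have row_injective (x : psk N) : Injective fun y => entry (x, y) :=
    e.injective.comp ((hf.2 (φ.symm x)).comp φ.symm.injective)
  have column_injective (y : psk N) : Injective fun x => entry (x, y) :=
    e.injective.comp ((hf.1 (φ.symm y)).comp φ.symm.injective)
  have : Finite (psk N) := .of_equiv _ φ
  have row_surjective : Surjective fun y => entry (φ 0, y) :=
    (row_injective _).surjective_of_finite (φ.symm.trans (ZMod.finEquiv N).symm.toEquiv)
  refine ⟨⟨entry, fun x _ _ => (row_injective x).ne, fun _ _ y => (column_injective y).ne⟩,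
    fun t => (row_surjective t).imp' (φ 0, ·) fun _ => id, fun c hc p hp q hq => ?_⟩
  refine congrArg e (hfs _ _ _ _ (mul_left_cancel₀ hz ?_))
  have effectivePoint_eq (p : psk N × psk N) : effectivePoint s p =
      z * (stdAddChar (φ.symm p.1) + s * stdAddChar (φ.symm p.2)) := by
    rw [mul_add, mul_left_comm, ← hφ, ← hφ, φ.apply_symm_apply, φ.apply_symm_apply,
      effectivePoint]
  rw [← effectivePoint_eq, ← effectivePoint_eq]
  exact hc.2.1 p hp q hq

theorem exists_latinSquare_removes {n : ℕ} (hn : 3 ≤ n)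
    (hs : IsSingularFadeState (psk (2 ^ n)) s) :
    ∃ L : LatinSquare (psk (2 ^ n)) (Fin (2 ^ n)), Surjective L.entry ∧ L.Removes s := by
  obtain ⟨a₀, a₁, b₀, b₁, ha, hb, h₀⟩ := hs.exists_sub_eq
  by_cases hkl : a₀ - a₁ = b₀ - b₁ ∨ a₀ - a₁ = -(b₀ - b₁)
  · obtain ⟨m, rfl⟩ := exists_eq_stdAddChar_of_sub_eq (by omega) hb h₀ hkl
    obtain ⟨f, hf, hfs⟩ := exists_resolves_stdAddChar (by omega) m
    exact exists_latinSquare_of_resolves (by simp) hf hfs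
  · obtain ⟨hkl, hkl'⟩ := not_or.1 hkl
    obtain ⟨f, hf, hfc⟩ := exists_compatible hn (sub_ne_zero.2 ha) (sub_ne_zero.2 hb) hkl hkl'
    refine exists_latinSquare_of_resolves (ZMod.card _) ?_
      (hfc.resolves (by omega) ha hb hkl hkl' h₀)
    exact ⟨fun b => (hf.1 b).comp sub_left_injective, fun a => hf.2 _⟩

end Constellation

section Coloring

variable {S : Set ℂ} {s : ℂ}

theorem isRemovalConstraint_fibre (s : ℂ) (p : S × S) :
    IsRemovalConstraint S s {q | effectivePoint s q = effectivePoint s p} :=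
  ⟨⟨p, rfl⟩, fun _ hq _ hr => hq.trans hr.symm, fun _ hq _ hr e => hr (e.symm.trans hq)⟩

theorem IsRemovalConstraint.eq_fibre {c : Set (S × S)} (hc : IsRemovalConstraint S s c)
    {p : S × S} (hp : p ∈ c) : c = {q | effectivePoint s q = effectivePoint s p} :=
  Set.ext fun q => ⟨fun hq => hc.2.1 q hq p hp, fun hq => by
    by_contra hqc
    exact hc.2.2 p hp q hqc hq.symm⟩

theorem LatinSquare.exists_coloring {T : Type} (L : LatinSquare S T)
    (hL : Surjective L.entry) (hs : L.Removes s) :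
    ∃ C : (removalGraph S s).Coloring T, Surjective C := by
  let color (c : RemovalConstraint S s) : T := L.entry c.2.1.choose
  have color_eq (c : RemovalConstraint S s) {p} (hp : p ∈ c.1) : color c = L.entry p :=
    hs c.1 c.2 _ c.2.1.choose_spec p hp
  have valid {c d} (hcd : (removalGraph S s).Adj c d) : color c ≠ color d := by
    obtain ⟨hne, ⟨a, b⟩, hp, ⟨a', b'⟩, hq, h⟩ := hcd
    rw [color_eq c hp, color_eq d hq]
    have hpq : (a, b) ≠ (a', b') := fun hpq =>
      hne (Subtype.ext ((c.2.eq_fibre hp).trans (hpq ▸ (d.2.eq_fibre hq).symm)))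
    rcases h with rfl | rfl
    · exact L.row_exclusion _ _ _ fun h => hpq (by rw [h])
    · exact L.col_exclusion _ _ _ fun h => hpq (by rw [h])
  refine ⟨SimpleGraph.Coloring.mk color valid, fun t => ?_⟩
  obtain ⟨p, rfl⟩ := hL t
  exact ⟨⟨_, isRemovalConstraint_fibre s p⟩, color_eq _ rfl⟩

end Coloring

end TwoWayRelay

theorem mainTheorem3 (l : ℕ) (hl : 3 ≤ l) (s : ℂ)
    (hs : TwoWayRelay.IsSingularFadeState (TwoWayRelay.psk (2 ^ l)) s) :
    (∃ L : TwoWayRelay.LatinSquare (TwoWayRelay.psk (2 ^ l)) (Fin (2 ^ l)),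
      Function.Surjective L.entry ∧ L.Removes s) ∧
    (∃ C : (TwoWayRelay.removalGraph (TwoWayRelay.psk (2 ^ l)) s).Coloring (Fin (2 ^ l)),
      Function.Surjective C) := by
  obtain ⟨L, hL, hLs⟩ := TwoWayRelay.exists_latinSquare_removes hl hs
  exact ⟨⟨L, hL, hLs⟩, L.exists_coloring hL hLs⟩
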